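/- There is an absolute constant $C>0$ such that the following holds for all integers $n\ge 0$ and $d\ge 1$. Let $$P(z)=\sum_{|\alpha|\le d} c_\alpha z^\alpha,\qquad z=(z_1,\dots,z_n),\ \alpha\in\mathbb{Z}_{\ge 0}^n,\ |\alpha|=\alpha_1+\dots+\alpha_n,$$ be a (not necessarily homogeneous) polynomial of degree at most $d$ in $n$ complex variables with $|c_\alpha|=1$ for every multi-index $\alpha$ with $|\alpha|\le d$. Then $$\Big(\sum_{|\alpha|\le d}|c_\alpha|^{\frac{2d}{d+1}}\Big)^{\frac{d+1}{2d}}\le C\,\exp\Big(\frac{2\sqrt2}{\sqrt3}\sqrt{d\log d}+\frac{4\sqrt2}{\sqrt3}\sqrt{\frac{d}{\log d}}\Big)\,\|P\|_{L^\infty(\mathbb{T}^n)},$$ where $\|P\|_{L^\infty(\mathbb{T}^n)}=\max\{|P(z)| : |z_1|=\dots=|z_n|=1\}$. For $d=1$, where $\log d=0$, the term $\sqrt{d/\log d}$ is read as $0$, i.e. the bound holds with the right-hand side $C\,\|P\|_{L^\infty(\mathbb{T}^n)}$. -/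

import Mathlib

noncomputable section

/-- The finite set of multi-indices `α ∈ ℕⁿ` with `|α| = α₁ + ⋯ + αₙ ≤ d`. -/
def multiIndices (n d : ℕ) : Finset (Fin n →₀ ℕ) :=
  (Finset.range (d + 1)).biUnion fun k => Finset.finsuppAntidiag Finset.univ k

theorem mem_multiIndices {n d : ℕ} {α : Fin n →₀ ℕ} :
    α ∈ multiIndices n d ↔ ∑ j, α j ≤ d := by
  simp [multiIndices, Finset.mem_finsuppAntidiag]

/-- `‖P‖_{L^∞(𝕋ⁿ)}`: the maximum of `|P(z)|` over `z ∈ 𝕋ⁿ`, where `𝕋` is the unit circle in `ℂ`. -/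
def torusNorm {n : ℕ} (P : MvPolynomial (Fin n) ℂ) : ℝ :=
  ⨆ z : Fin n → Circle, ‖MvPolynomial.eval (fun j => (z j : ℂ)) P‖

/-- The supremum defining `torusNorm` is attained, so it is a genuine maximum. -/
theorem isGreatest_torusNorm {n : ℕ} (P : MvPolynomial (Fin n) ℂ) :
    IsGreatest (Set.range fun z : Fin n → Circle =>
      ‖MvPolynomial.eval (fun j => (z j : ℂ)) P‖) (torusNorm P) := by
  have hc : Continuous fun z : Fin n → Circle =>
      ‖MvPolynomial.eval (fun j => (z j : ℂ)) P‖ :=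
    ((MvPolynomial.continuous_eval P).comp
      (continuous_pi fun j => continuous_subtype_val.comp (continuous_apply j))).norm
  exact (isCompact_range hc).isGreatest_sSup (Set.range_nonempty _)

end

/-!
Write `A = (n + d).choose d` for the number of multi-indices. All coefficients being unimodular, the
left-hand side is `A ^ ((d + 1) / (2 * d))`, so a lower bound for the norm `X = ‖P‖_∞` is needed.

If `n < 2 * d`, Parseval's identity `A ≤ X ^ 2` suffices, because `A ^ (1 / d)` is bounded.

If `n ≥ 2 * d`, take `k = ⌊√d⌋` disjoint blocks of `N = ⌊n / (2 * d)⌋` variables each, let `w`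
denote the `b = n - k * N` remaining variables, and for `i : Fin k → Fin N` let `f i w` be the
coefficient of the monomial `∏ l, z (l, i l)` in `P`. This is a polynomial of degree at most `m = d - k` in `w`
with unimodular coefficients. Two facts are combined.

* For fixed `w` and each `l`, `∑ s, (∑ i with i l = s, |f i w| ^ 2) ^ (1 / 2) ≤ 2 ^ k * X`
  (`sum_sqrt_sum_norm_sq_coeff_le`): averaging over rotations of the blocks extracts the multilinear
  part, rotating the variables of block `l` separately turns a sum into a sum of absolute
  values, and a Khinchin-type inequality passes from `L¹` to `L²`.
* `‖f i‖₄ ^ 4 ≤ 4 ^ m * ‖f i‖₂ ^ 4` (`expect_norm_pow_four_le`), by comparing the coefficients of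
  the square of a polynomial with those of the polynomial.

An interpolation of Blei type (`expect_sum_sq_pow_le`) derives from these
`N ^ (k + 1) * (b + m).choose m ≤ 4 ^ (k + m / k) * X ^ 2`, and elementary estimates of binomial
coefficients turn this into `A ^ ((d + 1) / (2 * d)) ≤ exp (4 * √d + 4) * X`. By the
arithmetic-geometric mean inequality, the exponent in the theorem is at least `4 * √d` for `d ≥ 2`.

Integrals over the torus are replaced throughout by averages over `D`-th roots of unity with `D`
larger than the degrees involved, for which the monomials are still orthonormal.
-/

open Finset MvPolynomial
open scoped BigOperators ComplexConjugate

/-! ### Orthogonality of monomials on a finite torus -/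

/-- The point of the torus `𝕋^τ` whose coordinates are the `D`-th roots of unity indexed by `x`.
Averages over `x` replace integrals over the torus. -/
noncomputable def torusPoint (D : ℕ) [NeZero D] {τ : Type*} (x : τ → ZMod D) : τ → ℂ :=
  fun j => ZMod.stdAddChar (x j)

theorem norm_torusPoint {D : ℕ} [NeZero D] {τ : Type*} (x : τ → ZMod D) (j : τ) :
    ‖torusPoint D x j‖ = 1 :=
  AddChar.norm_apply _ _

theorem expect_stdAddChar_pow {D : ℕ} [NeZero D] {a b : ℕ} (ha : a < D) (hb : b < D) :
    𝔼 x : ZMod D, (ZMod.stdAddChar x : ℂ) ^ a * conj ((ZMod.stdAddChar x : ℂ) ^ b) =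
      if a = b then 1 else 0 := by
  have h : ∀ x : ZMod D, (ZMod.stdAddChar x : ℂ) ^ a * conj ((ZMod.stdAddChar x : ℂ) ^ b) =
      ZMod.stdAddChar (x * ((a : ZMod D) - (b : ZMod D))) := by
    intro x
    rw [map_pow, ← AddChar.map_neg_eq_conj, ← AddChar.map_nsmul_eq_pow,
      ← AddChar.map_nsmul_eq_pow, ← AddChar.map_add_eq_mul]
    congr 1
    simp only [nsmul_eq_mul]
    ring
  have h0 : ((a : ZMod D) - (b : ZMod D) = 0) ↔ a = b := by
    rw [sub_eq_zero, ZMod.natCast_eq_natCast_iff', Nat.mod_eq_of_lt ha, Nat.mod_eq_of_lt hb]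
  rw [Fintype.expect_eq_sum_div_card, sum_congr rfl fun x _ => h x,
    AddChar.sum_mulShift _ (ZMod.isPrimitive_stdAddChar D)]
  by_cases hab : a = b
  · simp [hab]
  · simp [hab, h0]

/-- Orthogonality of monomials of degree less than `D` in each variable. -/
theorem expect_monomial_mul_conj {D : ℕ} [NeZero D] {τ : Type*} [Fintype τ] [DecidableEq τ]
    {a b : τ → ℕ}
    (ha : ∀ j, a j < D) (hb : ∀ j, b j < D) :
    𝔼 x : τ → ZMod D, (∏ j, torusPoint D x j ^ a j) * conj (∏ j, torusPoint D x j ^ b j) =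
      if a = b then 1 else 0 := by
  have h : ∀ x : τ → ZMod D,
      (∏ j, torusPoint D x j ^ a j) * conj (∏ j, torusPoint D x j ^ b j) =
        ∏ j, ((ZMod.stdAddChar (x j) : ℂ) ^ a j * conj ((ZMod.stdAddChar (x j) : ℂ) ^ b j)) := by
    intro x
    rw [map_prod, ← prod_mul_distrib]
    rfl
  have hsum : ∑ x : τ → ZMod D, ∏ j,
      ((ZMod.stdAddChar (x j) : ℂ) ^ a j * conj ((ZMod.stdAddChar (x j) : ℂ) ^ b j)) =
      ∏ j, ∑ y : ZMod D,
        ((ZMod.stdAddChar y : ℂ) ^ a j * conj ((ZMod.stdAddChar y : ℂ) ^ b j)) := by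
    rw [prod_univ_sum, Fintype.piFinset_univ]
  have hone : ∀ j, (∑ y : ZMod D,
      ((ZMod.stdAddChar y : ℂ) ^ a j * conj ((ZMod.stdAddChar y : ℂ) ^ b j))) / (D : ℂ) =
      if a j = b j then 1 else 0 := by
    intro j
    rw [← expect_stdAddChar_pow (ha j) (hb j), Fintype.expect_eq_sum_div_card, ZMod.card]
  rw [expect_congr rfl fun x _ => h x, Fintype.expect_eq_sum_div_card, hsum, Fintype.card_fun,
    ZMod.card, Nat.cast_pow, ← card_univ, ← prod_const, ← prod_div_distrib,
    prod_congr rfl fun j _ => hone j]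
  by_cases hab : a = b
  · simp [hab]
  · obtain ⟨j, hj⟩ := Function.ne_iff.mp hab
    rw [if_neg hab]
    exact prod_eq_zero (mem_univ j) (if_neg hj)

/-- Parseval's identity on the finite torus. -/
theorem expect_norm_sq_eval {D : ℕ} [NeZero D] {τ : Type*} [Fintype τ] [DecidableEq τ]
    (q : MvPolynomial τ ℂ) (hq : q.totalDegree < D) :
    𝔼 x : τ → ZMod D, ‖eval (torusPoint D x) q‖ ^ 2 = ∑ α ∈ q.support, ‖q.coeff α‖ ^ 2 := by
  have hlt : ∀ α ∈ q.support, ∀ j, α j < D := fun α hα j =>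
    ((Finsupp.le_degree j α).trans (le_totalDegree hα)).trans_lt hq
  apply Complex.ofReal_injective
  have h : ∀ x : τ → ZMod D, ((‖eval (torusPoint D x) q‖ ^ 2 : ℝ) : ℂ) =
      ∑ α ∈ q.support, ∑ β ∈ q.support, q.coeff α * conj (q.coeff β) *
        ((∏ j, torusPoint D x j ^ α j) * conj (∏ j, torusPoint D x j ^ β j)) := by
    intro x
    push_cast
    rw [← Complex.mul_conj', eval_eq', map_sum, sum_mul_sum]
    refine sum_congr rfl fun α _ => sum_congr rfl fun β _ => ?_
    rw [map_mul]
    ring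
  have hE : ((𝔼 x : τ → ZMod D, ‖eval (torusPoint D x) q‖ ^ 2 : ℝ) : ℂ) =
      𝔼 x : τ → ZMod D, ((‖eval (torusPoint D x) q‖ ^ 2 : ℝ) : ℂ) := by
    rw [Fintype.expect_eq_sum_div_card, Fintype.expect_eq_sum_div_card]
    push_cast
    rfl
  rw [hE, expect_congr rfl fun x _ => h x, expect_sum_comm]
  push_cast
  refine sum_congr rfl fun α hα => ?_
  rw [expect_sum_comm, sum_eq_single α]
  · rw [← mul_expect, expect_monomial_mul_conj (hlt α hα) (hlt α hα), if_pos rfl, mul_one,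
      Complex.mul_conj']
  · intro β hβ hne
    rw [← mul_expect, expect_monomial_mul_conj (hlt α hα) (hlt β hβ), if_neg, mul_zero]
    exact fun h => hne (DFunLike.coe_injective h).symm
  · exact fun h => absurd hα h

/-! ### Comparison of `L¹`-, `L²`- and `L⁴`-norms on the torus -/

theorem card_antidiagonal_le_two_pow_degree {τ : Type*} [DecidableEq τ] (α : τ →₀ ℕ) :
    (antidiagonal α).card ≤ 2 ^ α.degree := by
  calc (antidiagonal α).card ≤ (Iic α).card := by
        refine card_le_card_of_injOn Prod.fst ?_ ?_
        · intro p hp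
          have := mem_antidiagonal.mp hp
          simp [← this]
        · intro p hp r hr h
          have h1 := mem_antidiagonal.mp hp
          have h2 := mem_antidiagonal.mp hr
          refine Prod.ext h ?_
          rw [← h2, h] at h1
          exact add_left_cancel h1
    _ = ∏ i ∈ α.support, (α i + 1) := by simp [Finsupp.card_Iic]
    _ ≤ ∏ i ∈ α.support, 2 ^ α i := prod_le_prod' fun i _ => Nat.lt_two_pow_self
    _ = 2 ^ α.degree := by rw [prod_pow_eq_pow_sum]; rfl

/-- The `L⁴`-norm of a polynomial of degree `m` on the torus is at most `2 ^ (m / 2)` times its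
`L²`-norm: each coefficient of `q ^ 2` is a sum of at most `2 ^ (2 * m)` products. -/
theorem expect_norm_pow_four_le {D : ℕ} [NeZero D] {τ : Type*} [Fintype τ] [DecidableEq τ]
    (q : MvPolynomial τ ℂ) {m : ℕ} (hq : q.totalDegree ≤ m) (hD : 2 * m < D) :
    𝔼 x : τ → ZMod D, ‖eval (torusPoint D x) q‖ ^ 4 ≤
      4 ^ m * (∑ α ∈ q.support, ‖q.coeff α‖ ^ 2) ^ 2 := by
  have hdeg : (q * q).totalDegree ≤ 2 * m :=
    (totalDegree_mul q q).trans (by omega)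
  -- the polynomial with coefficients `‖q.coeff α‖ ^ 2`
  set r : MvPolynomial τ ℝ := ∑ α ∈ q.support, monomial α (‖q.coeff α‖ ^ 2) with hr
  have hrc : ∀ α, r.coeff α = ‖q.coeff α‖ ^ 2 := by
    intro α
    rw [hr, coeff_sum]
    simp only [coeff_monomial]
    rw [sum_ite_eq']
    split_ifs with h
    · rfl
    · rw [notMem_support_iff.mp h]; simp
  have hr1 : eval (fun _ => (1 : ℝ)) r = ∑ α ∈ q.support, ‖q.coeff α‖ ^ 2 := by
    rw [hr, map_sum]
    refine sum_congr rfl fun α _ => ?_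
    simp [eval_monomial]
  have hcoef : ∀ α ∈ (q * q).support, ‖(q * q).coeff α‖ ^ 2 ≤ 4 ^ m * (r * r).coeff α := by
    intro α hα
    have hα2 : α.degree ≤ 2 * m := (le_totalDegree hα).trans hdeg
    rw [coeff_mul, coeff_mul]
    calc ‖∑ p ∈ antidiagonal α, q.coeff p.1 * q.coeff p.2‖ ^ 2
        ≤ (∑ p ∈ antidiagonal α, ‖q.coeff p.1 * q.coeff p.2‖) ^ 2 := by
          gcongr; exact norm_sum_le _ _
      _ ≤ (antidiagonal α).card * ∑ p ∈ antidiagonal α, ‖q.coeff p.1 * q.coeff p.2‖ ^ 2 :=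
          sq_sum_le_card_mul_sum_sq
      _ ≤ 4 ^ m * ∑ p ∈ antidiagonal α, r.coeff p.1 * r.coeff p.2 := by
          gcongr with p hp
          · have h1 : ((antidiagonal α).card : ℝ) ≤ 2 ^ α.degree := by
              exact_mod_cast card_antidiagonal_le_two_pow_degree α
            refine h1.trans ?_
            calc (2 : ℝ) ^ α.degree ≤ 2 ^ (2 * m) := pow_le_pow_right₀ (by norm_num) hα2
              _ = 4 ^ m := by rw [pow_mul]; norm_num
          · rw [hrc, hrc, norm_mul, mul_pow]
  have hsupp : ∑ α ∈ (q * q).support, (r * r).coeff α ≤ eval (fun _ => (1 : ℝ)) (r * r) := by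
    have hnn : ∀ α, 0 ≤ (r * r).coeff α := fun α => by
      rw [coeff_mul]
      exact sum_nonneg fun p _ => by rw [hrc, hrc]; positivity
    rw [eval_eq']
    simp only [one_pow, prod_const_one, mul_one]
    rw [← sum_filter_add_sum_filter_not (q * q).support (fun α => α ∈ (r * r).support),
      sum_eq_zero (s := filter (fun α => ¬ α ∈ (r * r).support) _), add_zero]
    · exact sum_le_sum_of_subset_of_nonneg (fun α hα => (mem_filter.mp hα).2) fun α _ _ => hnn α
    · intro α hα
      exact notMem_support_iff.mp (mem_filter.mp hα).2
  have h4 : ∀ x : τ → ZMod D, ‖eval (torusPoint D x) q‖ ^ 4 =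
      ‖eval (torusPoint D x) (q * q)‖ ^ 2 := fun x => by
    rw [map_mul, norm_mul]; ring
  rw [expect_congr rfl fun x _ => h4 x, expect_norm_sq_eval _ (hdeg.trans_lt hD)]
  calc ∑ α ∈ (q * q).support, ‖(q * q).coeff α‖ ^ 2
      ≤ ∑ α ∈ (q * q).support, 4 ^ m * (r * r).coeff α := sum_le_sum hcoef
    _ = 4 ^ m * ∑ α ∈ (q * q).support, (r * r).coeff α := (mul_sum _ _ _).symm
    _ ≤ 4 ^ m * eval (fun _ => (1 : ℝ)) (r * r) := by gcongr
    _ = _ := by rw [map_mul, hr1]; ring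

/-- Khinchin-type inequality: the `L²`-norm of a polynomial of degree `m` on the torus is at most
`2 ^ m` times its `L¹`-norm. It follows from the `L⁴` bound by log-convexity. -/
theorem sqrt_sum_norm_sq_le_expect_norm {D : ℕ} [NeZero D] {τ : Type*} [Fintype τ] [DecidableEq τ]
    (q : MvPolynomial τ ℂ) {m : ℕ} (hq : q.totalDegree ≤ m) (hD : 2 * m < D) :
    √(∑ α ∈ q.support, ‖q.coeff α‖ ^ 2) ≤
      2 ^ m * 𝔼 x : τ → ZMod D, ‖eval (torusPoint D x) q‖ := by
  have h4 := expect_norm_pow_four_le q hq hD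
  have h2 := expect_norm_sq_eval q (show q.totalDegree < D by omega)
  set A := ∑ α ∈ q.support, ‖q.coeff α‖ ^ 2 with hA
  set u : (τ → ZMod D) → ℝ := fun x => ‖eval (torusPoint D x) q‖ with hu
  have hu0 : ∀ x, 0 ≤ u x := fun x => norm_nonneg _
  set E1 := 𝔼 x, u x with hE1
  have hE10 : 0 ≤ E1 := expect_nonneg fun x _ => hu0 x
  set E3 := 𝔼 x, u x ^ 3 with hE3
  have hA0 : 0 ≤ A := sum_nonneg fun _ _ => by positivity
  have c1 : A ^ 2 ≤ E1 * E3 := by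
    have := expect_mul_sq_le_sq_mul_sq univ (fun x => √(u x)) (fun x => √(u x) * u x)
    have e1 : ∀ x, √(u x) * (√(u x) * u x) = u x ^ 2 := fun x => by
      rw [← mul_assoc, Real.mul_self_sqrt (hu0 x)]; ring
    have e2 : ∀ x, √(u x) ^ 2 = u x := fun x => Real.sq_sqrt (hu0 x)
    have e3 : ∀ x, (√(u x) * u x) ^ 2 = u x ^ 3 := fun x => by
      rw [mul_pow, e2]; ring
    simp only [e1, e2, e3] at this
    rwa [h2] at this
  have c2 : E3 ^ 2 ≤ A * (4 ^ m * A ^ 2) := by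
    have := expect_mul_sq_le_sq_mul_sq univ (fun x => u x) (fun x => u x ^ 2)
    have e1 : ∀ x, u x * u x ^ 2 = u x ^ 3 := fun x => by ring
    have e2 : ∀ x, (u x ^ 2) ^ 2 = u x ^ 4 := fun x => by ring
    simp only [e1, e2] at this
    rw [h2] at this
    exact this.trans (by gcongr)
  have key : A ≤ 4 ^ m * E1 ^ 2 := by
    rcases hA0.eq_or_lt with h0 | hpos
    · rw [← h0]; positivity
    · have : A ^ 3 * A ≤ A ^ 3 * (4 ^ m * E1 ^ 2) := by
        calc A ^ 3 * A = (A ^ 2) ^ 2 := by ring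
          _ ≤ (E1 * E3) ^ 2 := by gcongr
          _ = E1 ^ 2 * E3 ^ 2 := by ring
          _ ≤ E1 ^ 2 * (A * (4 ^ m * A ^ 2)) := by gcongr
          _ = _ := by ring
      exact le_of_mul_le_mul_left this (by positivity)
  rw [show 2 ^ m * E1 = √((2 ^ m * E1) ^ 2) from (Real.sqrt_sq (by positivity)).symm]
  apply Real.sqrt_le_sqrt
  calc A ≤ 4 ^ m * E1 ^ 2 := key
    _ = (2 ^ m * E1) ^ 2 := by
      rw [mul_pow, ← pow_mul, mul_comm m 2, pow_mul]; norm_num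

/-! ### Multilinear parts of polynomials -/

/-- The exponent of the multilinear monomial `∏ l, z (l, i l)`, which picks one variable from each
block `{l} × ι`. -/
noncomputable def transversal {κ ι : Type*} [Fintype κ] [Fintype ι] [DecidableEq ι] (i : κ → ι) :
    κ × ι →₀ ℕ :=
  Finsupp.equivFunOnFinite.symm fun q => if i q.1 = q.2 then 1 else 0

section Multilinear

variable {κ ι : Type*} [Fintype κ] [Fintype ι] [DecidableEq ι]

theorem transversal_apply (i : κ → ι) (q : κ × ι) :
    transversal i q = if i q.1 = q.2 then 1 else 0 := rfl

theorem transversal_injective : Function.Injective (transversal : (κ → ι) → κ × ι →₀ ℕ) := by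
  intro i i' h
  funext l
  have := DFunLike.congr_fun h (l, i l)
  simp only [transversal_apply, if_true] at this
  by_contra hne
  rw [if_neg (Ne.symm hne)] at this
  exact one_ne_zero this

theorem sum_transversal (i : κ → ι) : ∑ q, transversal i q = Fintype.card κ := by
  rw [Fintype.sum_prod_type]
  simp [transversal_apply]

theorem prod_pow_transversal (i : κ → ι) (z : κ × ι → ℂ) :
    ∏ q, z q ^ transversal i q = ∏ l, z (l, i l) := by
  rw [Fintype.prod_prod_type]
  refine prod_congr rfl fun l _ => ?_
  rw [prod_eq_single (i l)]
  · simp [transversal_apply]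
  · intro s _ hs
    simp [transversal_apply, Ne.symm hs]
  · simp

theorem exists_transversal_eq {α : κ × ι →₀ ℕ} (h : ∀ l, ∑ s, α (l, s) = 1) :
    ∃ i : κ → ι, transversal i = α := by
  have h1 : ∀ l, ∃ s, ∀ s', α (l, s') = if s = s' then 1 else 0 := by
    intro l
    have hl := h l
    obtain ⟨s, -, hs⟩ : ∃ s ∈ univ, α (l, s) ≠ 0 := exists_ne_zero_of_sum_ne_zero (by omega)
    have hsplit := add_sum_erase univ (fun s => α (l, s)) (mem_univ s)
    refine ⟨s, fun s' => ?_⟩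
    split_ifs with hss
    · subst hss; omega
    · have h0 : ∑ t ∈ univ.erase s, α (l, t) = 0 := by omega
      exact sum_eq_zero_iff.mp h0 s' (by simp [Ne.symm hss])
  choose i hi using h1
  exact ⟨i, Finsupp.ext fun q => (hi q.1 q.2).symm⟩

variable [DecidableEq κ]

/-- The multilinear part of `p` is an average of rotations of `p`, the variables of each block being
rotated together. -/
theorem expect_eval_rotate {D : ℕ} [NeZero D] (hD : 1 < D) (p : MvPolynomial (κ × ι) ℂ)
    (hp : p.totalDegree < D) (z : κ × ι → ℂ) :
    𝔼 t : κ → ZMod D, conj (∏ l, torusPoint D t l) * eval (fun q => torusPoint D t q.1 * z q) p =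
      ∑ i : κ → ι, p.coeff (transversal i) * ∏ l, z (l, i l) := by
  have h : ∀ t : κ → ZMod D,
      conj (∏ l, torusPoint D t l) * eval (fun q => torusPoint D t q.1 * z q) p =
        ∑ α ∈ p.support, p.coeff α * (∏ q, z q ^ α q) *
          ((∏ l, torusPoint D t l ^ ∑ s, α (l, s)) * conj (∏ l, torusPoint D t l ^ 1)) := by
    intro t
    rw [eval_eq', mul_sum]
    refine sum_congr rfl fun α _ => ?_
    simp only [mul_pow, prod_mul_distrib, pow_one, ← prod_pow_eq_pow_sum]
    rw [← Fintype.prod_prod_type' fun l s => torusPoint D t l ^ α (l, s)]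
    ring
  rw [expect_congr rfl fun t _ => h t, expect_sum_comm]
  have h2 : ∀ α ∈ p.support, 𝔼 t : κ → ZMod D, p.coeff α * (∏ q, z q ^ α q) *
      ((∏ l, torusPoint D t l ^ ∑ s, α (l, s)) * conj (∏ l, torusPoint D t l ^ 1)) =
      if α ∈ univ.image (transversal : (κ → ι) → _) then p.coeff α * (∏ q, z q ^ α q) else 0 := by
    intro α hα
    have hlt : ∀ l, ∑ s, α (l, s) < D := by
      intro l
      refine lt_of_le_of_lt ?_ hp
      refine le_trans ?_ (le_totalDegree hα)
      rw [Finsupp.sum_fintype _ _ fun _ => rfl, Fintype.sum_prod_type]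
      exact single_le_sum (f := fun l => ∑ s, α (l, s)) (fun _ _ => Nat.zero_le _) (mem_univ l)
    rw [← mul_expect, expect_monomial_mul_conj hlt fun _ => hD, mul_ite, mul_one, mul_zero]
    congr 1
    rw [eq_iff_iff]
    constructor
    · intro hα1
      obtain ⟨i, hi⟩ := exists_transversal_eq fun l => congr_fun hα1 l
      exact mem_image.mpr ⟨i, mem_univ _, hi⟩
    · intro hα1
      obtain ⟨i, -, rfl⟩ := mem_image.mp hα1
      funext l
      simp [transversal_apply]
  rw [sum_congr rfl h2, ← sum_filter, filter_mem_eq_inter,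
    sum_subset inter_subset_right, sum_image transversal_injective.injOn]
  · exact sum_congr rfl fun i _ => by rw [prod_pow_transversal]
  · intro α hα hα2
    have : α ∉ p.support := fun h => hα2 (mem_inter.mpr ⟨h, hα⟩)
    rw [notMem_support_iff.mp this, zero_mul]

theorem norm_multilinear_part_le (p : MvPolynomial (κ × ι) ℂ) {M : ℝ}
    (hM : ∀ z : κ × ι → ℂ, (∀ q, ‖z q‖ = 1) → ‖eval z p‖ ≤ M) (z : κ × ι → ℂ)
    (hz : ∀ q, ‖z q‖ = 1) :
    ‖∑ i : κ → ι, p.coeff (transversal i) * ∏ l, z (l, i l)‖ ≤ M := by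
  rw [← expect_eval_rotate (D := p.totalDegree + 2) (by omega) p (by omega) z]
  refine (RCLike.norm_expect_le (K := ℂ)).trans ?_
  refine expect_le univ_nonempty fun t _ => ?_
  rw [norm_mul, RCLike.norm_conj, norm_prod]
  simp only [norm_torusPoint, prod_const_one, one_mul]
  refine hM _ fun q => ?_
  rw [norm_mul, norm_torusPoint, hz, one_mul]

/-- Rotating the variables of the block `l` makes the contributions of its variables add up. -/
theorem sum_norm_partial_multilinear_le (p : MvPolynomial (κ × ι) ℂ) {M : ℝ}
    (hM : ∀ z : κ × ι → ℂ, (∀ q, ‖z q‖ = 1) → ‖eval z p‖ ≤ M) (z : κ × ι → ℂ)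
    (hz : ∀ q, ‖z q‖ = 1) (l : κ) :
    ∑ s, ‖∑ i : κ → ι with i l = s, p.coeff (transversal i) * ∏ m, z (m, i m)‖ ≤ M := by
  set q : ι → ℂ := fun s => ∑ i : κ → ι with i l = s, p.coeff (transversal i) * ∏ m, z (m, i m)
    with hq
  have hu : ∀ s, ∃ u : ℂ, ‖u‖ = 1 ∧ u * q s = ‖q s‖ := by
    intro s
    by_cases h : q s = 0
    · exact ⟨1, by simp, by simp [h]⟩
    · have hn : (‖q s‖ : ℂ) ≠ 0 := by exact_mod_cast norm_ne_zero_iff.mpr h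
      refine ⟨conj (q s) / ‖q s‖, ?_, ?_⟩
      · rw [norm_div, RCLike.norm_conj, Complex.norm_real, norm_norm]
        exact div_self (norm_ne_zero_iff.mpr h)
      · rw [div_mul_eq_mul_div, mul_comm, Complex.mul_conj', sq, mul_div_assoc, div_self hn,
          mul_one]
  choose u hu1 hu2 using hu
  have hle := norm_multilinear_part_le p hM
    (fun x => (if x.1 = l then u x.2 else 1) * z x) (fun x => by
      rw [norm_mul, hz, mul_one]
      split_ifs
      · exact hu1 _
      · simp)
  have heq : ∑ i : κ → ι, p.coeff (transversal i) *
      ∏ m, ((if m = l then u (i m) else 1) * z (m, i m)) = ((∑ s, ‖q s‖ : ℝ) : ℂ) := by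
    push_cast
    rw [← sum_fiberwise univ fun i : κ → ι => i l]
    refine sum_congr rfl fun s _ => ?_
    rw [← hu2 s, hq, mul_sum]
    refine sum_congr rfl fun i hi => ?_
    rw [prod_mul_distrib, prod_ite_eq' univ l fun m => u (i m), if_pos (mem_univ l),
      (mem_filter.mp hi).2]
    ring
  rw [heq, Complex.norm_real] at hle
  exact (le_abs_self _).trans hle

/-- Mixed `ℓ¹`-`ℓ²` inequality for the multilinear coefficients of a polynomial bounded by `M` on
the torus. -/
theorem sum_sqrt_sum_norm_sq_coeff_le (p : MvPolynomial (κ × ι) ℂ) {M : ℝ}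
    (hM : ∀ z : κ × ι → ℂ, (∀ q, ‖z q‖ = 1) → ‖eval z p‖ ≤ M) (l : κ) :
    ∑ s, √(∑ i : κ → ι with i l = s, ‖p.coeff (transversal i)‖ ^ 2) ≤
      2 ^ Fintype.card κ * M := by
  set D := 2 * Fintype.card κ + 1 with hD
  set q : ι → MvPolynomial (κ × ι) ℂ := fun s =>
    ∑ i : κ → ι with i l = s, monomial (transversal i) (p.coeff (transversal i)) with hq
  have hdeg : ∀ s, (q s).totalDegree ≤ Fintype.card κ := by
    intro s
    refine totalDegree_finsetSum_le fun i _ => (totalDegree_monomial_le _ _).trans ?_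
    rw [Finsupp.sum_fintype _ _ fun _ => rfl]
    exact (sum_transversal i).le
  have hcoef : ∀ s, ∑ α ∈ (q s).support, ‖(q s).coeff α‖ ^ 2 =
      ∑ i : κ → ι with i l = s, ‖p.coeff (transversal i)‖ ^ 2 := by
    intro s
    have hc : ∀ i : κ → ι, i l = s → (q s).coeff (transversal i) = p.coeff (transversal i) := by
      intro i hi
      rw [hq, coeff_sum]
      simp only [coeff_monomial, transversal_injective.eq_iff]
      rw [sum_ite_eq', if_pos (by simp [hi])]
    have hsub : (q s).support ⊆ (univ.filter fun i : κ → ι => i l = s).image transversal := by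
      intro α hα
      by_contra hn
      refine mem_support_iff.mp hα ?_
      rw [hq, coeff_sum]
      refine sum_eq_zero fun i hi => ?_
      rw [coeff_monomial, if_neg]
      rintro rfl
      exact hn (mem_image_of_mem _ hi)
    rw [sum_subset hsub, sum_image transversal_injective.injOn]
    · exact sum_congr rfl fun i hi => by rw [hc i (mem_filter.mp hi).2]
    · intro α _ hα
      rw [notMem_support_iff.mp hα]; simp
  have heval : ∀ s z, eval z (q s) =
      ∑ i : κ → ι with i l = s, p.coeff (transversal i) * ∏ m, z (m, i m) := by
    intro s z
    rw [hq, map_sum]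
    refine sum_congr rfl fun i _ => ?_
    rw [eval_monomial, Finsupp.prod_fintype _ _ fun _ => pow_zero _, prod_pow_transversal]
  calc ∑ s, √(∑ i : κ → ι with i l = s, ‖p.coeff (transversal i)‖ ^ 2)
      ≤ ∑ s, 2 ^ Fintype.card κ * 𝔼 x : κ × ι → ZMod D, ‖eval (torusPoint D x) (q s)‖ := by
        refine sum_le_sum fun s _ => ?_
        rw [← hcoef s]
        exact sqrt_sum_norm_sq_le_expect_norm (q s) (hdeg s) (by omega)
    _ = 2 ^ Fintype.card κ *
        𝔼 x : κ × ι → ZMod D, ∑ s, ‖eval (torusPoint D x) (q s)‖ := by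
        rw [← mul_sum, expect_sum_comm]
    _ ≤ 2 ^ Fintype.card κ * M := by
        gcongr
        refine expect_le univ_nonempty fun x _ => ?_
        simp only [heval]
        exact sum_norm_partial_multilinear_le p hM _ (norm_torusPoint x) l

end Multilinear

/-! ### Interpolation between mixed norms -/

theorem prod_le_arith_mean_pow {n : ℕ} (hn : 0 < n) (x : Fin n → ℝ) (hx : ∀ i, 0 ≤ x i) :
    ∏ i, x i ≤ ((∑ i, x i) / n) ^ n := by
  have h := Real.geom_mean_le_arith_mean univ (fun _ => 1) x (fun _ _ => zero_le_one)
    (by simpa using hn) fun i _ => hx i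
  simp only [Real.rpow_one, one_mul, sum_const, card_univ, Fintype.card_fin, nsmul_eq_mul,
    mul_one] at h
  calc ∏ i, x i = ((∏ i, x i) ^ ((n : ℝ)⁻¹)) ^ n :=
        (Real.rpow_inv_natCast_pow (prod_nonneg fun i _ => hx i) hn.ne').symm
    _ ≤ _ := pow_le_pow_left₀ (Real.rpow_nonneg (prod_nonneg fun i _ => hx i) _) h n

/-- If the families `f · ω` satisfy mixed `ℓ¹`-`ℓ²` bounds in each of the `k` directions, then their
`ℓ²`-mass is controlled by their `ℓ⁴`-mass. With `w l s` the `s`-th summand of the bound in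
direction `l`, divided by `M`, this is the arithmetic-geometric mean inequality for
`f ^ (2 * (k + 2)) = (∏ l, f ^ 2 / w l (i l)) * (∏ l, w l (i l)) * f ^ 4`. -/
theorem expect_sum_sq_pow_le {k : ℕ} {ι Ω : Type*} [Fintype ι] [DecidableEq ι] [Fintype Ω]
    [Nonempty Ω] (f : (Fin k → ι) → Ω → ℝ) (hf : ∀ i ω, 0 ≤ f i ω) {M Z : ℝ} (hM : 0 < M)
    (hZ : 0 < Z) (h1 : ∀ ω l, ∑ s, √(∑ i : Fin k → ι with i l = s, f i ω ^ 2) ≤ M)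
    (h4 : 𝔼 ω, ∑ i, f i ω ^ 4 ≤ Z) :
    (𝔼 ω, ∑ i, f i ω ^ 2) ^ (k + 2) ≤ M ^ (2 * k) * Z := by
  set w : Ω → Fin k → ι → ℝ := fun ω l s => √(∑ i : Fin k → ι with i l = s, f i ω ^ 2) / M with hw
  have hw0 : ∀ ω l s, 0 ≤ w ω l s := fun ω l s => by positivity
  have hw1 : ∀ ω l, ∑ s, w ω l s ≤ 1 := by
    intro ω l
    rw [hw, ← sum_div, div_le_one hM]
    exact h1 ω l
  have hfw : ∀ ω l i, f i ω ^ 2 ≤ (w ω l (i l) * M) ^ 2 := by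
    intro ω l i
    rw [hw]
    simp only
    rw [div_mul_cancel₀ _ hM.ne', Real.sq_sqrt (sum_nonneg fun _ _ => sq_nonneg _)]
    exact single_le_sum (f := fun i => f i ω ^ 2) (fun _ _ => sq_nonneg _) (by simp)
  -- `R` normalises the product of the `k + 2` factors below to `(f i ω ^ 2 / R) ^ (k + 2)`
  set R : ℝ := (M ^ (2 * k) * Z) ^ (((k + 2 : ℕ) : ℝ)⁻¹) with hR
  have hRpos : 0 < R := by positivity
  have hRpow : R ^ (k + 2) = M ^ (2 * k) * Z :=
    Real.rpow_inv_natCast_pow (by positivity) (by omega)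
  have hpt : ∀ i ω, f i ω ^ 2 / R ≤ (∑ l, f i ω ^ 2 / (w ω l (i l) * M ^ 2) +
      (∏ l, w ω l (i l) + f i ω ^ 4 / Z)) / (k + 2 : ℕ) := by
    intro i ω
    have hnn : 0 ≤ (∑ l, f i ω ^ 2 / (w ω l (i l) * M ^ 2) +
        (∏ l, w ω l (i l) + f i ω ^ 4 / Z)) / (k + 2 : ℕ) := by
      have a1 : 0 ≤ ∑ l, f i ω ^ 2 / (w ω l (i l) * M ^ 2) := sum_nonneg fun l _ =>
        div_nonneg (sq_nonneg _) (mul_nonneg (hw0 _ _ _) (sq_nonneg _))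
      have a2 : 0 ≤ ∏ l, w ω l (i l) := prod_nonneg fun l _ => hw0 _ _ _
      have a3 : 0 ≤ f i ω ^ 4 / Z := by positivity
      positivity
    rcases (hf i ω).eq_or_lt with h0 | hpos
    · rw [← h0] at hnn ⊢
      simpa using hnn
    have hwpos : ∀ l, 0 < w ω l (i l) := by
      intro l
      refine lt_of_le_of_ne (hw0 _ _ _) fun h => ?_
      have := hfw ω l i
      rw [← h, zero_mul] at this
      nlinarith
    set x : Fin (k + 2) → ℝ := Fin.cons (∏ l, w ω l (i l)) (Fin.cons (f i ω ^ 4 / Z)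
      fun l => f i ω ^ 2 / (w ω l (i l) * M ^ 2)) with hx
    have hx0 : ∀ j, 0 ≤ x j := by
      intro j
      refine Fin.cases ?_ (fun j => Fin.cases ?_ (fun l => ?_) j) j
      · change 0 ≤ ∏ l, w ω l (i l)
        exact prod_nonneg fun l _ => hw0 _ _ _
      · exact div_nonneg (by positivity) hZ.le
      · exact div_nonneg (sq_nonneg _) (mul_nonneg (hw0 _ _ _) (sq_nonneg _))
    have hprod : ∏ j, x j = (f i ω ^ 2 / R) ^ (k + 2) := by
      rw [Fin.prod_univ_succ, Fin.prod_univ_succ]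
      simp only [hx, Fin.cons_zero, Fin.cons_succ]
      have hden : ∏ l, f i ω ^ 2 / (w ω l (i l) * M ^ 2) =
          (f i ω ^ 2) ^ k / ((∏ l, w ω l (i l)) * (M ^ 2) ^ k) := by
        refine (prod_div_distrib _ _).trans ?_
        congr 1
        · simp
        · refine prod_mul_distrib.trans ?_
          simp
      rw [hden, div_pow, hRpow]
      have hne : ∏ l, w ω l (i l) ≠ 0 := (prod_pos fun l _ => hwpos l).ne'
      field_simp
      ring
    have hsum : ∑ j, x j = ∑ l, f i ω ^ 2 / (w ω l (i l) * M ^ 2) +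
        (∏ l, w ω l (i l) + f i ω ^ 4 / Z) := by
      rw [Fin.sum_univ_succ, Fin.sum_univ_succ]
      simp only [hx, Fin.cons_zero, Fin.cons_succ]
      ring
    have := prod_le_arith_mean_pow (by omega) x hx0
    rw [hprod, hsum] at this
    exact le_of_pow_le_pow_left₀ (by omega) hnn this
  have hX : ∀ ω l, ∑ i : Fin k → ι, f i ω ^ 2 / (w ω l (i l) * M ^ 2) ≤ 1 := by
    intro ω l
    rw [← sum_fiberwise univ fun i : Fin k → ι => i l]
    refine le_trans (sum_le_sum fun s _ => ?_) (hw1 ω l)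
    calc ∑ i : Fin k → ι with i l = s, f i ω ^ 2 / (w ω l (i l) * M ^ 2)
        = ∑ i : Fin k → ι with i l = s, f i ω ^ 2 / (w ω l s * M ^ 2) :=
          sum_congr rfl fun i hi => by rw [(mem_filter.mp hi).2]
      _ = (w ω l s * M) ^ 2 / (w ω l s * M ^ 2) := by
          rw [← sum_div]
          congr 1
          simp only [hw]
          rw [div_mul_cancel₀ _ hM.ne', Real.sq_sqrt (sum_nonneg fun _ _ => sq_nonneg _)]
      _ ≤ w ω l s := by
          rcases (hw0 ω l s).eq_or_lt with h | h
          · rw [← h]; simp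
          · rw [div_le_iff₀ (by positivity)]; nlinarith
  have hY : ∀ ω, ∑ i : Fin k → ι, ∏ l, w ω l (i l) ≤ 1 := by
    intro ω
    have := prod_univ_sum (fun _ : Fin k => (univ : Finset ι)) fun l s => w ω l s
    rw [Fintype.piFinset_univ] at this
    rw [← this]
    exact prod_le_one (fun l _ => sum_nonneg fun s _ => hw0 _ _ _) fun l _ => hw1 ω l
  have hmain : (𝔼 ω, ∑ i, f i ω ^ 2) / R ≤ 1 := by
    rw [expect_div]
    calc 𝔼 ω, (∑ i, f i ω ^ 2) / R
        ≤ 𝔼 ω, (((k : ℝ) + 1) / (k + 2 : ℕ) + (∑ i, f i ω ^ 4) * (1 / (Z * (k + 2 : ℕ)))) := by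
          refine expect_le_expect fun ω _ => ?_
          rw [sum_div]
          refine (sum_le_sum fun i _ => hpt i ω).trans ?_
          rw [← sum_div, sum_add_distrib, sum_add_distrib, sum_comm, ← sum_div]
          have a1 : ∑ l : Fin k, ∑ i : Fin k → ι, f i ω ^ 2 / (w ω l (i l) * M ^ 2) ≤ k := by
            refine (sum_le_sum fun l _ => hX ω l).trans ?_
            simp
          have a2 := hY ω
          have e : ((k : ℝ) + 1) / (k + 2 : ℕ) + (∑ i, f i ω ^ 4) * (1 / (Z * (k + 2 : ℕ))) =
              (k + (1 + (∑ i, f i ω ^ 4) / Z)) / (k + 2 : ℕ) := by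
            field_simp
            ring
          rw [e]
          gcongr
      _ = ((k : ℝ) + 1) / (k + 2 : ℕ) + (𝔼 ω, ∑ i, f i ω ^ 4) * (1 / (Z * (k + 2 : ℕ))) := by
          rw [expect_add_distrib, Fintype.expect_const, expect_mul]
      _ ≤ ((k : ℝ) + 1) / (k + 2 : ℕ) + Z * (1 / (Z * (k + 2 : ℕ))) := by gcongr
      _ = 1 := by
          push_cast
          field_simp
          ring
  rw [div_le_one hRpos] at hmain
  rw [← hRpow]
  exact pow_le_pow_left₀ (expect_nonneg fun ω _ => sum_nonneg fun i _ => sq_nonneg _) hmain _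

/-! ### Polynomials in two groups of variables and the number of monomials -/

theorem sumAlgEquiv_monomial {A B R : Type*} [CommSemiring R] (u : A ⊕ B →₀ ℕ) (c : R) :
    sumAlgEquiv R A B (monomial u c) =
      monomial (u.comapDomain Sum.inl Sum.inl_injective.injOn)
        (monomial (u.comapDomain Sum.inr Sum.inr_injective.injOn) c) := by
  simp [sumAlgEquiv, monomial]

theorem coeff_coeff_sumAlgEquiv {A B R : Type*} [CommSemiring R] (P : MvPolynomial (A ⊕ B) R)
    (a : A →₀ ℕ) (b : B →₀ ℕ) :
    ((sumAlgEquiv R A B P).coeff a).coeff b = P.coeff (Finsupp.sumElim a b) := by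
  classical
  induction P using MvPolynomial.induction_on' with
  | monomial u c =>
    rw [sumAlgEquiv_monomial, coeff_monomial, coeff_monomial]
    by_cases ha : u.comapDomain Sum.inl Sum.inl_injective.injOn = a
    · rw [if_pos ha, coeff_monomial]
      congr 1
      rw [eq_iff_iff]
      constructor
      · rintro rfl
        rw [← ha]
        ext (x | x) <;> simp
      · rintro rfl
        ext x
        simp
    · rw [if_neg ha, if_neg, coeff_zero]
      rintro rfl
      apply ha
      ext x
      simp
  | add p q hp hq => simp [hp, hq]

theorem eval_map_sumAlgEquiv {A B R : Type*} [CommSemiring R] (P : MvPolynomial (A ⊕ B) R)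
    (z : A → R) (w : B → R) :
    eval z (map (eval w) (sumAlgEquiv R A B P)) = eval (Sum.elim z w) P := by
  induction P using MvPolynomial.induction_on with
  | C a => rw [sumAlgEquiv_C_inl]; simp
  | add p q hp hq => simp only [map_add, hp, hq]
  | mul_X p x hp =>
    rw [map_mul, map_mul, map_mul, map_mul, hp]
    rcases x with x | x
    · rw [sumAlgEquiv_X_inl]; simp
    · rw [sumAlgEquiv_X_inr]; simp

theorem sum_finsupp_sumElim {A B : Type*} [Fintype A] [Fintype B] (a : A →₀ ℕ) (b : B →₀ ℕ) :
    ∑ j, Finsupp.sumElim a b j = ∑ j, a j + ∑ j, b j := by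
  rw [Fintype.sum_sum_type]
  simp

theorem card_multiIndices (n d : ℕ) : (multiIndices n d).card = (n + d).choose d := by
  induction d with
  | zero =>
    have : multiIndices n 0 = {0} := by
      ext α
      rw [mem_multiIndices, mem_singleton]
      constructor
      · intro h
        ext j
        simpa using (sum_eq_zero_iff.mp (Nat.le_zero.mp h)) j (mem_univ j)
      · rintro rfl; simp
    simp [this]
  | succ d ih =>
    have h : multiIndices n (d + 1) =
        (multiIndices n d).disjUnion (Finset.finsuppAntidiag univ (d + 1)) (by
          rw [disjoint_left]
          intro α h1 h2
          rw [mem_multiIndices] at h1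
          have : ∑ j, α j = d + 1 := (mem_finsuppAntidiag.mp h2).1
          omega) := by
      ext α
      rw [mem_disjUnion, mem_multiIndices, mem_multiIndices, mem_finsuppAntidiag]
      simp only [subset_univ, and_true]
      change ∑ j, α j ≤ d + 1 ↔ ∑ j, α j ≤ d ∨ ∑ j, α j = d + 1
      omega
    rw [h, card_disjUnion, ih, card_finsuppAntidiag_nat_eq_choose, card_univ, Fintype.card_fin,
      show n + (d + 1) - 1 = n + d by omega, show n + (d + 1) = n + d + 1 by omega,
      Nat.choose_succ_succ]

/-! ### The lower bound for the norm -/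

/-- Lower bound for a polynomial with unimodular coefficients in `k` blocks of `N` variables and `b`
further variables, from the monomials that are linear in each block. -/
theorem pow_mul_choose_pow_le {k N b d : ℕ} (hN : 0 < N) (hkd : k ≤ d)
    (P : MvPolynomial ((Fin k × Fin N) ⊕ Fin b) ℂ) (hP : P.totalDegree ≤ d)
    (hc : ∀ α : (Fin k × Fin N) ⊕ Fin b →₀ ℕ, ∑ j, α j ≤ d → ‖P.coeff α‖ = 1) {M : ℝ}
    (hM0 : 0 < M) (hM : ∀ z, (∀ j, ‖z j‖ = 1) → ‖eval z P‖ ≤ M) :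
    (N : ℝ) ^ (k * (k + 1)) * ((b + (d - k)).choose (d - k) : ℝ) ^ k ≤
      (2 ^ k * M) ^ (2 * k) * 4 ^ (d - k) := by
  set m := d - k with hm
  set D := 2 * m + 1 with hD
  set S := sumAlgEquiv ℂ (Fin k × Fin N) (Fin b) P with hS
  set F : (Fin k → Fin N) → MvPolynomial (Fin b) ℂ := fun i => S.coeff (transversal i) with hF
  have hdeg (i : Fin k → Fin N) (γ : Fin b →₀ ℕ) :
      ∑ j, Finsupp.sumElim (transversal i) γ j = k + ∑ j, γ j := by
    rw [sum_finsupp_sumElim, sum_transversal, Fintype.card_fin]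
  have hFc (i : Fin k → Fin N) (γ : Fin b →₀ ℕ) :
      (F i).coeff γ = P.coeff (Finsupp.sumElim (transversal i) γ) :=
    coeff_coeff_sumAlgEquiv P _ _
  have hFone (i : Fin k → Fin N) (γ : Fin b →₀ ℕ) (hγ : ∑ j, γ j ≤ m) :
      ‖(F i).coeff γ‖ = 1 := by
    rw [hFc]
    exact hc _ (by rw [hdeg]; omega)
  have hFsupp (i : Fin k → Fin N) : (F i).support = multiIndices b m := by
    ext γ
    rw [mem_multiIndices, mem_support_iff]
    constructor
    · intro h
      rw [hFc] at h
      have := (le_totalDegree (mem_support_iff.mpr h)).trans hP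
      rw [Finsupp.sum_fintype _ _ fun _ => rfl, hdeg] at this
      omega
    · intro h h0
      have := hFone i γ h
      rw [h0, norm_zero] at this
      exact zero_ne_one this
  set B : ℝ := ((b + m).choose m : ℝ) with hB
  have hBpos : 0 < B := by
    rw [hB]
    exact_mod_cast Nat.choose_pos (Nat.le_add_left _ _)
  have hFsum (i : Fin k → Fin N) : ∑ γ ∈ (F i).support, ‖(F i).coeff γ‖ ^ 2 = B := by
    rw [hFsupp, sum_congr rfl fun γ hγ => by
      rw [hFone i γ (mem_multiIndices.mp hγ), one_pow], sum_const, card_multiIndices]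
    simp [hB]
  have hFdeg (i : Fin k → Fin N) : (F i).totalDegree ≤ m := by
    refine Finset.sup_le fun γ hγ => ?_
    rw [hFsupp, mem_multiIndices] at hγ
    rwa [Finsupp.sum_fintype _ _ fun _ => rfl]
  have hNpos : (0 : ℝ) < N := by exact_mod_cast hN
  have hE2 : 𝔼 x : Fin b → ZMod D, ∑ i, ‖eval (torusPoint D x) (F i)‖ ^ 2 = N ^ k * B := by
    rw [expect_sum_comm, sum_congr rfl fun i _ => by
      rw [expect_norm_sq_eval (F i) ((hFdeg i).trans_lt (by omega)), hFsum]]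
    simp
  have hE4 : 𝔼 x : Fin b → ZMod D, ∑ i, ‖eval (torusPoint D x) (F i)‖ ^ 4 ≤
      N ^ k * (4 ^ m * B ^ 2) := by
    rw [expect_sum_comm]
    refine (sum_le_sum fun i _ => ?_).trans_eq
      (b := ∑ _i : Fin k → Fin N, 4 ^ m * B ^ 2) ?_
    · have := expect_norm_pow_four_le (F i) (hFdeg i) (show 2 * m < D by omega)
      rwa [hFsum] at this
    · simp
  have h1 (x : Fin b → ZMod D) (l : Fin k) :
      ∑ s, √(∑ i : Fin k → Fin N with i l = s, ‖eval (torusPoint D x) (F i)‖ ^ 2) ≤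
        2 ^ k * M := by
    have := sum_sqrt_sum_norm_sq_coeff_le (map (eval (torusPoint D x)) S) (M := M)
      (fun z hz => by
        rw [hS, eval_map_sumAlgEquiv]
        refine hM _ ?_
        rintro (j | j)
        · exact hz j
        · exact norm_torusPoint x j) l
    simpa only [coeff_map, Fintype.card_fin] using this
  have key := expect_sum_sq_pow_le (fun i x => ‖eval (torusPoint D x) (F i)‖)
    (fun _ _ => norm_nonneg _) (by positivity) (by positivity) h1 hE4
  rw [hE2] at key
  have hpos : (0 : ℝ) < N ^ k * B ^ 2 := by positivity
  refine le_of_mul_le_mul_right ?_ hpos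
  calc (N : ℝ) ^ (k * (k + 1)) * B ^ k * (N ^ k * B ^ 2) = (N ^ k * B) ^ (k + 2) := by ring
    _ ≤ _ := key
    _ = _ := by ring

theorem norm_eval_le_torusNorm {n : ℕ} (P : MvPolynomial (Fin n) ℂ) (z : Fin n → ℂ)
    (hz : ∀ j, ‖z j‖ = 1) : ‖eval z P‖ ≤ torusNorm P :=
  (isGreatest_torusNorm P).2
    ⟨fun j => ⟨z j, mem_sphere_zero_iff_norm.mpr (hz j)⟩, rfl⟩

/-- The `L²` lower bound for a polynomial with unimodular coefficients. -/
theorem choose_le_torusNorm_sq {n d : ℕ} (P : MvPolynomial (Fin n) ℂ) (hP : P.totalDegree ≤ d)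
    (hc : ∀ α ∈ multiIndices n d, ‖P.coeff α‖ = 1) :
    ((n + d).choose d : ℝ) ≤ torusNorm P ^ 2 := by
  have hsub : multiIndices n d ⊆ P.support := fun α hα => by
    rw [mem_support_iff, ← norm_ne_zero_iff, hc α hα]
    exact one_ne_zero
  calc ((n + d).choose d : ℝ) = ∑ α ∈ multiIndices n d, ‖P.coeff α‖ ^ 2 := by
        rw [sum_congr rfl fun α hα => by rw [hc α hα, one_pow], sum_const, card_multiIndices]
        simp
    _ ≤ ∑ α ∈ P.support, ‖P.coeff α‖ ^ 2 :=
        sum_le_sum_of_subset_of_nonneg hsub fun _ _ _ => sq_nonneg _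
    _ = 𝔼 x : Fin n → ZMod (d + 1), ‖eval (torusPoint (d + 1) x) P‖ ^ 2 :=
        (expect_norm_sq_eval P (Nat.lt_succ_of_le hP)).symm
    _ ≤ torusNorm P ^ 2 := by
        refine expect_le univ_nonempty fun x _ => ?_
        gcongr
        exact norm_eval_le_torusNorm P _ (norm_torusPoint x)

theorem torusNorm_pos {n d : ℕ} (P : MvPolynomial (Fin n) ℂ) (hP : P.totalDegree ≤ d)
    (hc : ∀ α ∈ multiIndices n d, ‖P.coeff α‖ = 1) : 0 < torusNorm P := by
  have h := choose_le_torusNorm_sq P hP hc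
  have h1 : (0 : ℝ) < (n + d).choose d := by exact_mod_cast Nat.choose_pos (Nat.le_add_left _ _)
  have h0 : 0 ≤ torusNorm P := (norm_nonneg _).trans
    (norm_eval_le_torusNorm P (fun _ => 1) fun _ => norm_one)
  refine h0.lt_of_ne fun h2 => ?_
  rw [← h2] at h
  rw [zero_pow two_ne_zero] at h
  exact h1.not_ge h

/-- The bound `pow_mul_choose_pow_le` for a polynomial in `n = k * N + b` variables. -/
theorem pow_mul_choose_pow_le_torusNorm {n k N b d : ℕ} (hN : 0 < N) (hkd : k ≤ d)
    (hn : k * N + b = n) (P : MvPolynomial (Fin n) ℂ) (hP : P.totalDegree ≤ d)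
    (hc : ∀ α ∈ multiIndices n d, ‖P.coeff α‖ = 1) :
    (N : ℝ) ^ (k * (k + 1)) * ((b + (d - k)).choose (d - k) : ℝ) ^ k ≤
      (2 ^ k * torusNorm P) ^ (2 * k) * 4 ^ (d - k) := by
  let e : Fin n ≃ (Fin k × Fin N) ⊕ Fin b := Fintype.equivOfCardEq (by simp [hn])
  refine pow_mul_choose_pow_le hN hkd (rename e P) ((totalDegree_rename_le _ _).trans hP) ?_
    (torusNorm_pos P hP hc) ?_
  · intro α hα
    have h : α = Finsupp.mapDomain e (Finsupp.mapDomain e.symm α) := by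
      ext j
      simp [Finsupp.mapDomain_equiv_apply]
    rw [h, coeff_rename_mapDomain e e.injective]
    refine hc _ (mem_multiIndices.mpr ?_)
    simp only [Finsupp.mapDomain_equiv_apply, Equiv.symm_symm]
    rwa [Equiv.sum_comp e fun j => α j]
  · intro z hz
    rw [eval_rename]
    exact norm_eval_le_torusNorm P _ fun j => hz _

/-! ### Numerical estimates -/

/-- The ratio `(n + m).choose m / (b + m).choose m` is at most `(n / b) ^ m`. -/
theorem pow_mul_choose_le {n b : ℕ} (hbn : b ≤ n) (m : ℕ) :
    b ^ m * (n + m).choose m ≤ n ^ m * (b + m).choose m := by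
  induction m with
  | zero => simp
  | succ m ih =>
    have h1 := Nat.add_one_mul_choose_eq (n + m) m
    have h2 := Nat.add_one_mul_choose_eq (b + m) m
    refine Nat.le_of_mul_le_mul_right ?_ (Nat.succ_pos m)
    rw [← add_assoc, ← add_assoc, Nat.succ_eq_add_one]
    calc b ^ (m + 1) * (n + m + 1).choose (m + 1) * (m + 1)
        = (b * (n + m + 1)) * (b ^ m * (n + m).choose m) := by
          rw [mul_assoc, ← h1]; ring
      _ ≤ (n * (b + m + 1)) * (n ^ m * (b + m).choose m) := by
          refine Nat.mul_le_mul ?_ ih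
          nlinarith
      _ = n ^ (m + 1) * (b + m + 1).choose (m + 1) * (m + 1) := by
          rw [mul_assoc _ _ (m + 1), ← h2]; ring

theorem choose_le_pow_mul_choose {n d k : ℕ} (hd : 0 < d) (hdn : d ≤ n) (hk : 2 * k ≤ d + 2)
    (hkd : k ≤ d) :
    ((n + d).choose d : ℝ) ≤ (3 * (n / d)) ^ k * (n + (d - k)).choose (d - k) := by
  induction k with
  | zero => simp
  | succ k ih =>
    obtain ⟨e, he⟩ : ∃ e, d - k = e + 1 := ⟨d - k - 1, by omega⟩
    have he' : d - (k + 1) = e := by omega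
    refine (ih (by omega) (by omega)).trans ?_
    rw [he, he', pow_succ, mul_assoc]
    gcongr
    have h1 : ((n + e + 1 : ℕ) : ℝ) * (n + e).choose e =
        (n + e + 1).choose (e + 1) * ((e + 1 : ℕ) : ℝ) := by
      exact_mod_cast Nat.add_one_mul_choose_eq (n + e) e
    have he0 : (0 : ℝ) < ((e + 1 : ℕ) : ℝ) := by positivity
    refine le_of_mul_le_mul_right ?_ he0
    rw [← add_assoc, ← h1]
    have hd' : (0 : ℝ) < d := by exact_mod_cast hd
    have h2 : ((n + e + 1 : ℕ) : ℝ) ≤ 3 * (n / d) * ((e + 1 : ℕ) : ℝ) := by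
      have hed : (d : ℝ) ≤ 2 * ((e + 1 : ℕ) : ℝ) := by exact_mod_cast (by omega : d ≤ 2 * (e + 1))
      have hnd : (1 : ℝ) ≤ n / d := by
        rw [one_le_div hd']; exact_mod_cast hdn
      have hn : (n : ℝ) = n / d * d := by field_simp
      have : ((n + e + 1 : ℕ) : ℝ) = n + ((e + 1 : ℕ) : ℝ) := by push_cast; ring
      rw [this]
      nlinarith [mul_le_mul_of_nonneg_left hed (zero_le_one.trans hnd),
        mul_le_mul_of_nonneg_right hnd he0.le]
    calc ((n + e + 1 : ℕ) : ℝ) * (n + e).choose e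
        ≤ (3 * (n / d) * ((e + 1 : ℕ) : ℝ)) * (n + e).choose e := by gcongr
      _ = _ := by ring

theorem choose_le_exp_mul_pow {n d : ℕ} (hd : 0 < d) :
    ((n + d).choose d : ℝ) ≤ (Real.exp 1 * ((n + d) / d)) ^ d := by
  have hd' : (0 : ℝ) < d := by exact_mod_cast hd
  calc ((n + d).choose d : ℝ) ≤ ((n + d : ℕ) : ℝ) ^ d / d.factorial := Nat.choose_le_pow_div _ _
    _ = ((n + d) / d : ℝ) ^ d * ((d : ℝ) ^ d / d.factorial) := by
        push_cast; rw [div_pow]; field_simp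
    _ ≤ ((n + d) / d : ℝ) ^ d * Real.exp d := by
        gcongr; exact Real.pow_div_factorial_le_exp _ hd'.le _
    _ = _ := by rw [mul_pow, ← Real.exp_nat_mul, mul_one, mul_comm]

theorem log_choose_le {n d : ℕ} (hd : 0 < d) :
    Real.log ((n + d).choose d) ≤ d * (1 + Real.log ((n + d) / d)) := by
  have hd' : (0 : ℝ) < d := by exact_mod_cast hd
  have h := Real.log_le_log (by exact_mod_cast Nat.choose_pos (Nat.le_add_left _ _))
    (choose_le_exp_mul_pow (n := n) hd)
  rwa [Real.log_pow, Real.log_mul (Real.exp_pos 1).ne' (by positivity), Real.log_exp] at h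

theorem log_three_le : Real.log 3 ≤ 2 * Real.log 2 := by
  rw [← Real.log_rpow two_pos]
  exact Real.log_le_log (by norm_num) (by norm_num)

theorem log_four_eq : Real.log 4 = 2 * Real.log 2 := by
  rw [← Real.log_rpow two_pos]
  norm_num

/-- Removing `k` blocks of `N ≤ b / d` variables costs at most a factor `exp k` in the number of
monomials. -/
theorem log_choose_le_add {n d k N b m : ℕ} (hd : 1 ≤ d) (hb0 : 0 < b) (hb : k * N + b = n)
    (hdN : d * N ≤ b) (hmd : m ≤ d) :
    Real.log ((n + m).choose m) ≤ k + Real.log ((b + m).choose m) := by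
  have hd' : (0 : ℝ) < d := by exact_mod_cast hd
  have hb0' : (0 : ℝ) < b := by exact_mod_cast hb0
  have hn0 : (0 : ℝ) < n := by exact_mod_cast (by omega : 0 < n)
  have hB0 : (0 : ℝ) < (b + m).choose m := by
    exact_mod_cast Nat.choose_pos (Nat.le_add_left _ _)
  have hC0 : (0 : ℝ) < (n + m).choose m := by
    exact_mod_cast Nat.choose_pos (Nat.le_add_left _ _)
  have h1 : (b : ℝ) ^ m * (n + m).choose m ≤ (n : ℝ) ^ m * (b + m).choose m := by
    exact_mod_cast pow_mul_choose_le (by omega : b ≤ n) m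
  have h2 := Real.log_le_log (by positivity) h1
  rw [Real.log_mul (by positivity) (by positivity), Real.log_mul (by positivity) (by positivity),
    Real.log_pow, Real.log_pow] at h2
  have h3 : Real.log n - Real.log b ≤ k / d := by
    rw [← Real.log_div hn0.ne' hb0'.ne']
    refine (Real.log_le_sub_one_of_pos (by positivity)).trans ?_
    rw [sub_le_iff_le_add, div_le_iff₀ hb0', div_add_one hd'.ne', div_mul_eq_mul_div,
      le_div_iff₀ hd']
    have : n * d ≤ (k + d) * b := by
      calc n * d = k * (d * N) + d * b := by rw [← hb]; ring
        _ ≤ k * b + d * b := by gcongr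
        _ = (k + d) * b := by ring
    exact_mod_cast this
  have h4 : (m : ℝ) * (k / d) ≤ k := by
    rw [mul_div_assoc', div_le_iff₀ hd', mul_comm]
    gcongr
  have h5 := mul_le_mul_of_nonneg_left h3 (Nat.cast_nonneg m : (0 : ℝ) ≤ m)
  linarith

/-- The case of many variables: the lower bound of `pow_mul_choose_pow_le_torusNorm` with `k ≈ √d`
blocks of `N ≈ n / (2 * d)` variables. -/
theorem log_choose_add_le_of_two_mul_le {n d : ℕ} (hd : 1 ≤ d) (hn : 2 * d ≤ n)
    (P : MvPolynomial (Fin n) ℂ) (hP : P.totalDegree ≤ d)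
    (hc : ∀ α ∈ multiIndices n d, ‖P.coeff α‖ = 1) :
    Real.log ((n + d).choose d) + (1 + Real.log ((n + d) / d)) ≤
      2 * Real.log (torusNorm P) + 8 * √d + 8 := by
  have hX := torusNorm_pos P hP hc
  have hd' : (0 : ℝ) < d := by exact_mod_cast hd
  have hl2 := Real.log_two_lt_d9
  have hA0 : (0 : ℝ) < (n + d).choose d := by exact_mod_cast Nat.choose_pos (Nat.le_add_left _ _)
  set a := Real.log ((n + d).choose d) with ha
  set x := Real.log (torusNorm P) with hx
  set k := Nat.sqrt d with hk
  have hk2 : k * k ≤ d := Nat.sqrt_le d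
  have hk3 : d < (k + 1) * (k + 1) := Nat.lt_succ_sqrt d
  have hk1 : 1 ≤ k := Nat.sqrt_pos.mpr hd
  have hkd : k ≤ d := Nat.sqrt_le_self d
  have hk4 : 2 * k ≤ d + 2 := by
    have : (k : ℤ) * k ≤ d := by exact_mod_cast hk2
    zify
    nlinarith [sq_nonneg ((k : ℤ) - 1)]
  set N := n / (2 * d) with hN
  have hN1 : 1 ≤ N := (Nat.one_le_div_iff (by omega)).mpr hn
  have hNn : 2 * d * N ≤ n := Nat.mul_div_le n (2 * d)
  have hNn' : n < 2 * d * (N + 1) := Nat.lt_mul_div_succ n (by omega)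
  have hkN : k * N ≤ d * N := Nat.mul_le_mul_right N hkd
  have hkN' : k * N ≤ n := by nlinarith
  obtain ⟨b, hb⟩ := Nat.exists_eq_add_of_le hkN'
  have hbn : n ≤ 2 * b := by nlinarith
  have hb0 : 0 < b := by omega
  set m := d - k with hm
  have hB0 : (0 : ℝ) < (b + m).choose m := by
    exact_mod_cast Nat.choose_pos (Nat.le_add_left _ _)
  have hC0 : (0 : ℝ) < (n + m).choose m := by
    exact_mod_cast Nat.choose_pos (Nat.le_add_left _ _)
  set β := Real.log ((b + m).choose m) with hβ
  set ν := Real.log ((n : ℝ) / d) with hν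
  have hn0 : (0 : ℝ) < n := by exact_mod_cast (by omega : 0 < n)
  have hb0' : (0 : ℝ) < b := by exact_mod_cast hb0
  have hk0 : (0 : ℝ) < k := by exact_mod_cast hk1
  have hN0 : (0 : ℝ) < N := by exact_mod_cast hN1
  -- the analytic lower bound for the norm
  have e1 : (k + 1) * Real.log N + β ≤ 2 * (k * Real.log 2 + x) + m / k * Real.log 4 := by
    have h := Real.log_le_log (by positivity)
      (pow_mul_choose_pow_le_torusNorm hN1 hkd hb.symm P hP hc)
    rw [Real.log_mul (by positivity) (by positivity),
      Real.log_mul (by positivity) (by positivity), Real.log_pow, Real.log_pow, Real.log_pow,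
      Real.log_pow, Real.log_mul (by positivity) hX.ne', Real.log_pow] at h
    push_cast at h
    refine le_of_mul_le_mul_left ?_ hk0
    calc (k : ℝ) * ((k + 1) * Real.log N + β) = k * (k + 1) * Real.log N + k * β := by ring
      _ ≤ _ := h
      _ = k * (2 * (k * Real.log 2 + x) + m / k * Real.log 4) := by
        field_simp
        ring
  have e2 : ν - Real.log 4 ≤ Real.log N := by
    rw [hν, ← Real.log_div (by positivity) (by norm_num)]
    refine Real.log_le_log (by positivity) ?_
    rw [div_div, div_le_iff₀ (by positivity)]
    have : n ≤ N * (d * 4) := by nlinarith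
    exact_mod_cast this
  have e3 : (m : ℝ) / k ≤ k + 3 := by
    rw [div_le_iff₀ hk0]
    have : m ≤ (k + 3) * k := by
      have : m ≤ d := Nat.sub_le _ _
      nlinarith
    exact_mod_cast this
  have e4 : Real.log ((n + m).choose m) ≤ k + β :=
    log_choose_le_add hd hb0 hb.symm (by nlinarith) (Nat.sub_le _ _)
  have e5 : a ≤ k * (Real.log 3 + ν) + Real.log ((n + m).choose m) := by
    have h := Real.log_le_log hA0 (choose_le_pow_mul_choose hd (by omega : d ≤ n) hk4 hkd)
    rwa [Real.log_mul (by positivity) (by positivity), Real.log_pow,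
      Real.log_mul (by norm_num) (by positivity)] at h
  have e6 : Real.log ((n + d) / d) ≤ Real.log 2 + ν := by
    rw [hν, ← Real.log_mul (by norm_num) (by positivity)]
    refine Real.log_le_log (by positivity) ?_
    rw [← mul_div_assoc]
    gcongr
    exact_mod_cast (by omega : n + d ≤ 2 * n)
  have e7 : (k : ℝ) ≤ √d := Real.le_sqrt_of_sq_le (by exact_mod_cast (sq k).trans_le hk2)
  have e8 := mul_le_mul_of_nonneg_left e2 (by positivity : (0 : ℝ) ≤ k + 1)
  have e9 := mul_le_mul_of_nonneg_right e3 (by positivity : (0 : ℝ) ≤ Real.log 4)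
  have e10 := mul_le_mul_of_nonneg_left log_three_le hk0.le
  have e11 := mul_le_mul_of_nonneg_left hl2.le hk0.le
  rw [log_four_eq] at e8 e9 e1
  linarith

/-- The theorem in logarithmic form, with the exponent `4 * √d + 4`. -/
theorem log_choose_le_log_torusNorm {n d : ℕ} (hd : 1 ≤ d) (P : MvPolynomial (Fin n) ℂ)
    (hP : P.totalDegree ≤ d) (hc : ∀ α ∈ multiIndices n d, ‖P.coeff α‖ = 1) :
    Real.log ((n + d).choose d) * ((d + 1) / (2 * d)) ≤
      Real.log (torusNorm P) + 4 * √d + 4 := by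
  have hd' : (0 : ℝ) < d := by exact_mod_cast hd
  set a := Real.log ((n + d).choose d) with ha
  set x := Real.log (torusNorm P) with hx
  have hsplit : a * ((d + 1) / (2 * d)) = (a + a / d) / 2 := by field_simp
  have hA0 : (0 : ℝ) < (n + d).choose d := by exact_mod_cast Nat.choose_pos (Nat.le_add_left _ _)
  rw [hsplit]
  have had : a / d ≤ 1 + Real.log ((n + d) / d) := by
    rw [div_le_iff₀ hd', mul_comm]
    exact log_choose_le hd
  rcases lt_or_ge n (2 * d) with hn | hn
  · -- few variables: the `L²` bound is enough
    have h1 : a ≤ 2 * x := by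
      have := Real.log_le_log hA0 (choose_le_torusNorm_sq P hP hc)
      rwa [Real.log_pow] at this
    have h2 : Real.log ((n + d) / d) ≤ Real.log 3 := by
      refine Real.log_le_log (by positivity) ?_
      rw [div_le_iff₀ hd']
      exact_mod_cast (by omega : n + d ≤ 3 * d)
    linarith [log_three_le, Real.log_two_lt_d9, Real.sqrt_nonneg (d : ℝ)]
  · linarith [log_choose_add_le_of_two_mul_le hd hn P hP hc]

/-- The exponent of the theorem dominates `4 * √d`, by the inequality `t + 2 / t ≥ 5 / 2` with
`t = √(log d)`. -/
theorem four_mul_sqrt_le {d : ℕ} (hd : 2 ≤ d) :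
    4 * √(d : ℝ) ≤ 2 * √2 / √3 * √(d * Real.log d) + 4 * √2 / √3 * √(d / Real.log d) := by
  have hL : 0 < Real.log d := Real.log_pos (by exact_mod_cast hd)
  have hd0 : (0 : ℝ) ≤ d := Nat.cast_nonneg d
  have ht : 0 < √(Real.log d) := Real.sqrt_pos.mpr hL
  set t := √(Real.log d) with ht'
  have hK : (8 : ℝ) / 5 ≤ 2 * √2 / √3 := by
    rw [le_div_iff₀ (by positivity)]
    refine le_of_pow_le_pow_left₀ two_ne_zero (by positivity) ?_
    rw [mul_pow, mul_pow, Real.sq_sqrt (by norm_num), Real.sq_sqrt (by norm_num)]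
    norm_num
  have h1 : (5 : ℝ) / 2 ≤ t + 2 / t := by
    have : t + 2 / t = (t * t + 2) / t := by field_simp
    rw [this, le_div_iff₀ ht]
    nlinarith [sq_nonneg (t - 5 / 4)]
  rw [Real.sqrt_mul hd0, Real.sqrt_div hd0, ← ht']
  calc 4 * √(d : ℝ) = 8 / 5 * (√d * (5 / 2)) := by ring
    _ ≤ 2 * √2 / √3 * (√d * (t + 2 / t)) := by gcongr
    _ = _ := by ring

theorem mainTheorem2 :
    ∃ C : ℝ, 0 < C ∧
      ∀ (n d : ℕ), 1 ≤ d →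
        ∀ P : MvPolynomial (Fin n) ℂ, P.totalDegree ≤ d →
          (∀ α ∈ multiIndices n d, ‖P.coeff α‖ = 1) →
            (∑ α ∈ multiIndices n d, ‖P.coeff α‖ ^ ((2 * d : ℝ) / (d + 1))) ^
                (((d : ℝ) + 1) / (2 * d)) ≤
              C * Real.exp (2 * √2 / √3 * √(d * Real.log d) +
                  4 * √2 / √3 * √(d / Real.log d)) * torusNorm P := by
  refine ⟨Real.exp 8, Real.exp_pos 8, fun n d hd P hP hc => ?_⟩
  have hA0 : (0 : ℝ) < (n + d).choose d := by exact_mod_cast Nat.choose_pos (Nat.le_add_left _ _)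
  have hsum : ∑ α ∈ multiIndices n d, ‖P.coeff α‖ ^ ((2 * d : ℝ) / (d + 1)) =
      (n + d).choose d := by
    rw [sum_congr rfl fun α hα => by rw [hc α hα, Real.one_rpow], sum_const, card_multiIndices]
    simp
  rw [hsum, Real.rpow_def_of_pos hA0, ← Real.exp_add, ← Real.exp_log (torusNorm_pos P hP hc),
    ← Real.exp_add, Real.exp_le_exp]
  have h := log_choose_le_log_torusNorm hd P hP hc
  rcases hd.eq_or_lt with h1 | h2
  · -- for `d = 1` the exponent vanishes and the constant absorbs `4 * √d`
    subst h1
    simp only [Nat.cast_one, Real.sqrt_one, Real.log_one, mul_zero, div_zero, Real.sqrt_zero,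
      add_zero] at h ⊢
    linarith
  · linarith [four_mul_sqrt_le h2]
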